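/- Let $\Omega\subset\mathbb R^3$ be a bounded open set, let $\delta>0$, $\alpha\in\mathbb R$, $T>0$, let $x_1,\dots,x_N\in\mathbb R^3$, and let $(R_1,\dots,R_N,u)$ be a continuous, piecewise smooth solution on $[0,T)$ of the following problem. * Each $R_i:[0,T)\to[0,\infty)$ is continuous with $R_i(0)>0$, and once $R_i$ vanishes it stays zero. Put $t_i=\sup\{t\in[0,T): R_i(t)>0\}$. Particle $i$ is active at time $s$ if $R_i(s)>0$, and then $B_i(s)=\overline{B(x_i,\delta^\alpha R_i(s))}$. At each time $s\in[0,T)$ the closed balls $B_i(s)$ of the active particles are pairwise disjoint and contained in $\Omega$. Unions below run over the active particles. * For every $s\in(0,T)\setminus\{t_1,\dots,t_N\}$, the function $u(s,\cdot)$ satisfies $$-\Delta u=0\ \text{ in }\Omega\setminus\textstyle\bigcup_i B_i(s),\qquad u=\frac1{R_i(s)}+\dot R_i(s)\ \text{ on }\partial B_i(s)\text{ for every active } i,\qquad \nabla u\cdot n=0\ \text{ on }\partial\Omega ;$$ it is $C^1$ up to the spheres $\partial B_i(s)$, and $u(s,\cdot)$ and $\nabla u(s,\cdot)$ are square integrable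 on $\Omega\setminus\bigcup_i B_i(s)$. The condition on $\partial\Omega$ is understood weakly: $\int_{\Omega\setminus\bigcup B_i(s)}\nabla u\cdot\nabla\varphi=0$ for all $\varphi\in C^1(\Omega)$ with $\varphi,\nabla\varphi\in L^2(\Omega)$ that vanish in a neighbourhood of $\bigcup_i B_i(s)$. * For every such $s$ and every active $i$, the radius $R_i$ is differentiable at $s$ and, with $n$ the unit normal pointing out of $B_i(s)$, $$\dot R_i(s)=\frac1{4\pi\delta^{2\alpha}R_i(s)^2}\int_{\partial B_i(s)}\nabla u(s,\cdot)\cdot n\,\mathrm dS .$$ (Smoothness in time is used only in the form of the differentiability just stated.) Then for every $t\in(0,T)$ the functions $R_i^2|\dot R_i|^2$ and $s\mapsto\int_{\Omega\setminus\bigcup B_i(s)}|\nabla u(s,x)|^2\,\mathrm dx$ are integrable on $(0,t)$, and $$\sum_{i=1}^N\int_0^t R_i^2|\dot R_i|^2\,\mathrm ds+\frac12\sum_{i=1}^N R_i(t)^2+\frac1{4\pi\delta^{2\alpha}}\int_0^t\int_{\Omega\setminus\bigcup B_i(s)}|\nabla u(s,x)|^2\,\mathrm dx\,\mathrm ds=\frac12\sum_{i=1}^N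 R_i(0)^2 .$$ In particular, the total surface area $\sum_{i=1}^N 4\pi\delta^{2\alpha}R_i(t)^2$ is nonincreasing on $[0,T)$. -/

import Mathlib

open MeasureTheory Set

noncomputable section

namespace ReactionLSW

/-- Three-dimensional Euclidean space. -/
abbrev E3 : Type := EuclideanSpace ℝ (Fin 3)

/-- The integral of `f` over the sphere of centre `c` and radius `r` in `ℝ³` with respect to
surface area. Here `volume.toSphere` is the surface measure of the unit sphere, of total mass
`4 * π`. -/
def sphereIntegral (c : E3) (r : ℝ) (f : E3 → ℝ) : ℝ :=
  r ^ 2 * ∫ ω : Metric.sphere (0 : E3) 1, f (c + r • (ω : E3)) ∂((volume : Measure E3).toSphere)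

variable {N : ℕ}

/-- The particle phase at time `s`: the union of the closed balls with centre `x i` and radius
`δ ^ α * R i s`, over the active particles only (those with `0 < R i s`). -/
def particles (δ α : ℝ) (x : Fin N → E3) (R : Fin N → ℝ → ℝ) (s : ℝ) : Set E3 :=
  ⋃ i ∈ {i : Fin N | 0 < R i s}, Metric.closedBall (x i) (δ ^ α * R i s)

/-- The open region of `Ω` outside the particles at time `s`. -/
def bulk (Ω : Set E3) (δ α : ℝ) (x : Fin N → E3) (R : Fin N → ℝ → ℝ) (s : ℝ) : Set E3 :=
  Ω \ particles δ α x R s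

/-- The region of `Ω` outside the particles at time `s`, together with the boundary spheres of
the active particles (only the open balls are removed). -/
def bulkWithSpheres (Ω : Set E3) (δ α : ℝ) (x : Fin N → E3) (R : Fin N → ℝ → ℝ) (s : ℝ) :
    Set E3 :=
  Ω \ ⋃ i ∈ {i : Fin N | 0 < R i s}, Metric.ball (x i) (δ ^ α * R i s)

/-- The time at which particle `i` vanishes; it is `T` if the particle survives on `[0, T)`. -/
def extinctionTime (T : ℝ) (R : Fin N → ℝ → ℝ) (i : Fin N) : ℝ :=
  sSup {t : ℝ | t ∈ Ico 0 T ∧ 0 < R i t}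

/-- The flux `∫_{∂B_i} ∇v · n` through the boundary sphere of particle `i`, where `n` is the
normal pointing out of the particle and `∇v` on the sphere is the gradient taken from the outside
of the particles. -/
def particleFlux (Ω : Set E3) (δ α : ℝ) (x : Fin N → E3) (R : Fin N → ℝ → ℝ) (s : ℝ)
    (v : E3 → ℝ) (i : Fin N) : ℝ :=
  sphereIntegral (x i) (δ ^ α * R i s) fun y =>
    inner ℝ (gradientWithin v (bulkWithSpheres Ω δ α x R s) y) (‖y - x i‖⁻¹ • (y - x i))

/-- The no-flux condition `∇v · n = 0` on the outer boundary `∂Ω`, in its usual weak form, which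
needs no regularity of `∂Ω`: `∇v` is orthogonal in `L²` to the gradients of all
test functions with square-integrable value and gradient on `Ω` that vanish near the particle
phase `P` (and are not required to vanish near `∂Ω`). -/
def NoFluxOuter (Ω P : Set E3) (v : E3 → ℝ) : Prop :=
  ∀ φ : E3 → ℝ, ContDiffOn ℝ 1 φ Ω →
    (∃ U : Set E3, IsOpen U ∧ P ⊆ U ∧ ∀ y ∈ U, φ y = 0) →
    IntegrableOn (fun y => φ y ^ 2) Ω →
    IntegrableOn (fun y => ‖gradient φ y‖ ^ 2) Ω →
    ∫ y in Ω \ P, inner ℝ (gradient v y) (gradient φ y) = 0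

/-- The chemical-potential problem at a fixed time `s` for the function `v = u(s, ·)`. -/
structure IsChemicalPotential (Ω : Set E3) (δ α : ℝ) (x : Fin N → E3) (R : Fin N → ℝ → ℝ)
    (s : ℝ) (v : E3 → ℝ) : Prop where
  /-- `v` is harmonic outside the particles. -/
  harmonic : InnerProductSpace.HarmonicOnNhd v (bulk Ω δ α x R s)
  /-- `v` is `C¹` up to the boundary spheres of the particles. -/
  contDiffOn : ContDiffOn ℝ 1 v (bulkWithSpheres Ω δ α x R s)
  /-- `v` is square integrable outside the particles. -/
  sq_integrable : IntegrableOn (fun y => v y ^ 2) (bulk Ω δ α x R s)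
  /-- `v` has finite Dirichlet energy outside the particles. -/
  grad_sq_integrable : IntegrableOn (fun y => ‖gradient v y‖ ^ 2) (bulk Ω δ α x R s)
  /-- The Gibbs-Thomson law with kinetic drag on the boundary of each active particle. -/
  gibbsThomson : ∀ i, 0 < R i s → ∀ y ∈ Metric.sphere (x i) (δ ^ α * R i s),
    v y = 1 / R i s + deriv (R i) s
  /-- No flux through the outer boundary. -/
  noFlux : NoFluxOuter Ω (particles δ α x R s) v

/-- `(R, u)` is a continuous, piecewise smooth solution on `[0, T)` of the rescaled restricted
Stefan problem in `Ω` with particle centres `x`. Only differentiability of the radii away from the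
(finitely many) extinction times is required, so all piecewise smooth solutions are
included. -/
structure IsSolution (Ω : Set E3) (δ α T : ℝ) (x : Fin N → E3) (R : Fin N → ℝ → ℝ)
    (u : ℝ → E3 → ℝ) : Prop where
  /-- All particles are present initially. -/
  initial_pos : ∀ i, 0 < R i 0
  nonneg : ∀ i, ∀ s ∈ Ico 0 T, 0 ≤ R i s
  /-- A particle that has vanished does not reappear. -/
  extinct : ∀ i, ∀ s ∈ Ico 0 T, ∀ t ∈ Ico 0 T, s ≤ t → R i s = 0 → R i t = 0
  continuousOn : ∀ i, ContinuousOn (R i) (Ico 0 T)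
  /-- The particles lie in `Ω`. -/
  particle_subset : ∀ s ∈ Ico 0 T, ∀ i, 0 < R i s →
    Metric.closedBall (x i) (δ ^ α * R i s) ⊆ Ω
  /-- The particles do not collide. -/
  particle_disjoint : ∀ s ∈ Ico 0 T, ∀ i j, i ≠ j → 0 < R i s → 0 < R j s →
    Disjoint (Metric.closedBall (x i) (δ ^ α * R i s)) (Metric.closedBall (x j) (δ ^ α * R j s))
  /-- Away from the extinction times the radii of active particles are differentiable and grow
  with the averaged flux. -/
  growth : ∀ s ∈ Ioo 0 T, (∀ j, s ≠ extinctionTime T R j) → ∀ i, 0 < R i s →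
    HasDerivAt (R i)
      (1 / (4 * Real.pi * δ ^ (2 * α) * R i s ^ 2) * particleFlux Ω δ α x R s (u s) i) s
  /-- Away from the extinction times `u` solves the chemical-potential problem. -/
  potential : ∀ s ∈ Ioo 0 T, (∀ j, s ≠ extinctionTime T R j) →
    IsChemicalPotential Ω δ α x R s (u s)

/-- Total surface area of the particles at time `s`. -/
def surfaceArea (δ α : ℝ) (R : Fin N → ℝ → ℝ) (s : ℝ) : ℝ :=
  ∑ i, 4 * Real.pi * (δ ^ α * R i s) ^ 2

/-- The Dirichlet energy `∫ |∇u(s, ·)|²` over the region outside the particles at time `s`. -/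
def dirichletEnergy (Ω : Set E3) (δ α : ℝ) (x : Fin N → E3) (R : Fin N → ℝ → ℝ)
    (u : ℝ → E3 → ℝ) (s : ℝ) : ℝ :=
  ∫ y in bulk Ω δ α x R s, ‖gradient (u s) y‖ ^ 2

end ReactionLSW

end

noncomputable section

namespace ReactionLSW

open Filter Topology

/-! At a fixed time off the extinction times, test the equation with `u` itself. Since `u` equals
the constant `c i = 1 / R i + deriv (R i)` on the `i`-th sphere and there is no outer flux, the
Dirichlet energy is minus the sum of `c i` times the flux. The growth law makes the flux `4πδ^(2α)
R² Ṙ`, so the energy is `-4πδ^(2α) ∑ (R Ṙ + R² Ṙ²)`. As `R Ṙ` is the derivative of `R² / 2`,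
integration in time gives the identity.

In space, admissible test functions must vanish near the particles. So `u` is multiplied by a cutoff
at scale `h`, and polar coordinates show that the cutoff gradient concentrates on the spheres as `h
→ 0` (`tendsto_setIntegral_shell`, `integral_norm_gradient_sq_eq_neg_sum`).

In time, integrability is not assumed. Nonnegativity of the energy gives `∑ R² Ṙ² ≤ -f'` with `f = ½
∑ R²`. Hence `f` is nonincreasing, the derivative of a monotone function is integrable, and `-f'`
dominates the kinetic terms. -/

/-! ### Polar coordinates in `ℝ³` -/

theorem integral_eq_integral_sphereIntegral_zero {F : E3 → ℝ} (hF : Integrable F) :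
    ∫ y, F y = ∫ ρ in Ioi (0 : ℝ), sphereIntegral 0 ρ F := by
  have hmp := (volume : Measure E3).measurePreserving_homeomorphUnitSphereProd
  have hemb := (homeomorphUnitSphereProd E3).measurableEmbedding
  have hdim : Module.finrank ℝ E3 - 1 = 2 := by simp
  rw [hdim] at hmp
  have h1 : ∫ y, F y = ∫ y : ({0}ᶜ : Set E3), F y ∂((volume : Measure E3).comap (↑)) := by
    rw [integral_subtype_comap (measurableSet_singleton _).compl, restrict_compl_singleton]
  have hc : ∀ y : ({0}ᶜ : Set E3), F y =
      (fun p : Metric.sphere (0 : E3) 1 × Ioi (0 : ℝ) => F (p.2.1 • p.1.1))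
        (homeomorphUnitSphereProd E3 y) := by
    intro y
    have := congrArg Subtype.val ((homeomorphUnitSphereProd E3).symm_apply_apply y)
    rw [homeomorphUnitSphereProd_symm_apply_coe] at this
    simp only [this]
  have hi : Integrable (fun p : Metric.sphere (0 : E3) 1 × Ioi (0 : ℝ) => F (p.2.1 • p.1.1))
      ((volume : Measure E3).toSphere.prod (Measure.volumeIoiPow 2)) := by
    rw [← hmp.integrable_comp_emb hemb]
    have : Integrable (fun y : ({0}ᶜ : Set E3) => F y) ((volume : Measure E3).comap (↑)) := by
      have := (integrableOn_iff_comap_subtypeVal (μ := (volume : Measure E3)) (f := F)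
        (measurableSet_singleton (0 : E3)).compl).1 hF.integrableOn
      exact this
    refine this.congr (ae_of_all _ hc)
  rw [h1, integral_congr_ae (ae_of_all _ hc), hmp.integral_comp hemb
      (fun p : Metric.sphere (0 : E3) 1 × Ioi (0 : ℝ) => F (p.2.1 • p.1.1)), integral_prod_symm _ hi,
    Measure.volumeIoiPow]
  simp only [ENNReal.ofReal]
  rw [integral_withDensity_eq_integral_smul (f := fun r : Ioi (0 : ℝ) => Real.toNNReal (r.1 ^ 2)),
    integral_subtype_comap measurableSet_Ioi
      (fun a : ℝ => (Real.toNNReal (a ^ 2)) •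
        ∫ ω : Metric.sphere (0 : E3) 1, F (a • (ω : E3)) ∂((volume : Measure E3).toSphere))]
  · refine setIntegral_congr_fun measurableSet_Ioi fun a ha => ?_
    simp [sphereIntegral, NNReal.smul_def, Real.coe_toNNReal _ (sq_nonneg a)]
  · fun_prop

theorem integral_eq_integral_sphereIntegral (c : E3) {F : E3 → ℝ} (hF : Integrable F) :
    ∫ y, F y = ∫ ρ in Ioi (0 : ℝ), sphereIntegral c ρ F := by
  rw [← integral_add_left_eq_self F c, integral_eq_integral_sphereIntegral_zero (hF.comp_add_left c)]
  simp [sphereIntegral]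

/-- Dominated convergence on a compact shell. Including the inner radius is what later lets limits
land on the particle boundary. -/
theorem continuousOn_sphereIntegral {c : E3} {a b : ℝ} (ha : 0 ≤ a) {g : E3 → ℝ}
    (hg : ContinuousOn g {y | ‖y - c‖ ∈ Icc a b}) :
    ContinuousOn (fun ρ => sphereIntegral c ρ g) (Icc a b) := by
  have hK : IsCompact {y : E3 | ‖y - c‖ ∈ Icc a b} := by
    refine Metric.isCompact_of_isClosed_isBounded ?_ ?_
    · exact isClosed_Icc.preimage (by fun_prop)
    · refine (Metric.isBounded_closedBall (x := c) (r := b)).subset fun y hy => ?_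
      rw [mem_closedBall_iff_norm]; exact hy.2
  obtain ⟨C, hC⟩ := hK.exists_bound_of_continuousOn hg
  have hmem : ∀ ρ ∈ Icc a b, ∀ ω : Metric.sphere (0 : E3) 1,
      c + ρ • (ω : E3) ∈ {y : E3 | ‖y - c‖ ∈ Icc a b} := by
    intro ρ hρ ω
    simpa [norm_smul, abs_of_nonneg (ha.trans hρ.1)] using hρ
  refine ContinuousOn.mul (by fun_prop) (continuousOn_of_dominated (bound := fun _ => C) ?_ ?_ ?_ ?_)
  · intro ρ hρ
    refine (Continuous.aestronglyMeasurable ?_)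
    exact hg.comp_continuous (by fun_prop) (hmem ρ hρ)
  · exact fun ρ hρ => ae_of_all _ fun ω => hC _ (hmem ρ hρ ω)
  · exact integrable_const _
  · refine ae_of_all _ fun ω => ?_
    exact hg.comp (by fun_prop) fun ρ hρ => hmem ρ hρ ω

/-! ### Radial cutoffs and their concentration on a sphere -/

/-- A smooth function of `ρ` that rises from `0` to `1` as `ρ ^ 2` goes from `r ^ 2 + h` to
`r ^ 2 + 2 * h`. -/
def cutoffProfile (r h ρ : ℝ) : ℝ := Real.smoothTransition ((ρ ^ 2 - r ^ 2) / h - 1)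

theorem contDiff_cutoffProfile (r h : ℝ) : ContDiff ℝ 1 (cutoffProfile r h) := by
  unfold cutoffProfile
  exact Real.smoothTransition.contDiff.comp (by fun_prop)

theorem cutoffProfile_eq_zero {r h ρ : ℝ} (hh : 0 < h) (hρ : ρ ^ 2 ≤ r ^ 2 + h) :
    cutoffProfile r h ρ = 0 := by
  refine Real.smoothTransition.zero_of_nonpos ?_
  rw [sub_nonpos, div_le_one hh]; linarith

theorem cutoffProfile_eq_one {r h ρ : ℝ} (hh : 0 < h) (hρ : r ^ 2 + 2 * h ≤ ρ ^ 2) :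
    cutoffProfile r h ρ = 1 := by
  refine Real.smoothTransition.one_of_one_le ?_
  rw [le_sub_iff_add_le, le_div_iff₀ hh]; linarith

theorem deriv_cutoffProfile (r h ρ : ℝ) : deriv (cutoffProfile r h) ρ =
    deriv Real.smoothTransition ((ρ ^ 2 - r ^ 2) / h - 1) * (2 * ρ / h) := by
  have h1 : HasDerivAt (fun ρ : ℝ => (ρ ^ 2 - r ^ 2) / h - 1) (2 * ρ / h) ρ := by
    have := ((((hasDerivAt_id ρ).pow 2).sub_const (r ^ 2)).div_const h).sub_const 1
    simpa using this
  have h2 : HasDerivAt Real.smoothTransition _ ((ρ ^ 2 - r ^ 2) / h - 1) :=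
    ((Real.smoothTransition.contDiff (n := 1)).differentiable (by simp) _).hasDerivAt
  exact (h2.comp ρ h1).deriv

theorem deriv_cutoffProfile_nonneg {r h ρ : ℝ} (hh : 0 < h) (hρ : 0 ≤ ρ) :
    0 ≤ deriv (cutoffProfile r h) ρ := by
  rw [deriv_cutoffProfile]
  exact mul_nonneg Real.smoothTransition.monotone.deriv_nonneg (by positivity)

theorem deriv_cutoffProfile_eq_zero {r h ρ : ℝ} (hh : 0 < h) (hρ : r ^ 2 + 2 * h < ρ ^ 2) :
    deriv (cutoffProfile r h) ρ = 0 := by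
  have : cutoffProfile r h =ᶠ[𝓝 ρ] fun _ => 1 := by
    have : ∀ᶠ t in 𝓝 ρ, r ^ 2 + 2 * h < t ^ 2 :=
      (continuous_pow 2).continuousAt.eventually (lt_mem_nhds hρ)
    filter_upwards [this] with t ht using cutoffProfile_eq_one hh ht.le
  rw [this.deriv_eq]; simp

theorem deriv_cutoffProfile_eq_zero' {r h ρ : ℝ} (hh : 0 < h) (hρ : ρ ^ 2 < r ^ 2 + h) :
    deriv (cutoffProfile r h) ρ = 0 := by
  have : cutoffProfile r h =ᶠ[𝓝 ρ] fun _ => 0 := by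
    have : ∀ᶠ t in 𝓝 ρ, t ^ 2 < r ^ 2 + h :=
      (continuous_pow 2).continuousAt.eventually (gt_mem_nhds hρ)
    filter_upwards [this] with t ht using cutoffProfile_eq_zero hh ht.le
  rw [this.deriv_eq]; simp

/-- The derivatives of the cutoff profiles concentrate at `r` from the right. -/
theorem tendsto_integral_deriv_cutoffProfile_mul {r b : ℝ} (hr : 0 ≤ r) (hrb : r < b) {G : ℝ → ℝ}
    (hG : ContinuousOn G (Icc r b)) :
    Tendsto (fun h => ∫ ρ in r..b, deriv (cutoffProfile r h) ρ * G ρ) (𝓝[>] 0) (𝓝 (G r)) := by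
  rw [Metric.tendsto_nhds]
  intro ε hε
  obtain ⟨d, hd, hdG⟩ := Metric.continuousWithinAt_iff.1 (hG r ⟨le_rfl, hrb.le⟩) (ε / 2) (by linarith)
  -- On `[r, b')` the function `G` is within `ε / 2` of `G r`; for small `h` the kernel vanishes
  -- beyond `b'`.
  set b' := min b (r + d)
  have hb' : r < b' := lt_min hrb (by linarith)
  have hsmall : ∀ᶠ h in 𝓝[>] (0 : ℝ), r ^ 2 + 2 * h < b' ^ 2 := by
    have : Tendsto (fun h : ℝ => r ^ 2 + 2 * h) (𝓝[>] 0) (𝓝 (r ^ 2 + 2 * 0)) :=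
      (Continuous.tendsto (by fun_prop) _).mono_left nhdsWithin_le_nhds
    refine this.eventually (gt_mem_nhds ?_)
    nlinarith
  filter_upwards [hsmall, self_mem_nhdsWithin] with h hsm hh
  have hh : 0 < h := hh
  have hkc : Continuous (deriv (cutoffProfile r h)) :=
    (contDiff_cutoffProfile r h).continuous_deriv le_rfl
  have hbb : b' ≤ b := min_le_left _ _
  -- The kernel is nonnegative with unit mass, since the profile climbs from `0` to `1`: an
  -- approximate identity.
  have hint : ∫ ρ in r..b, deriv (cutoffProfile r h) ρ = 1 := by
    rw [intervalIntegral.integral_deriv_eq_sub'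
      (f := cutoffProfile r h) rfl
      (fun x _ => ((contDiff_cutoffProfile r h).differentiable (by simp)) x) hkc.continuousOn,
      cutoffProfile_eq_one hh (by nlinarith), cutoffProfile_eq_zero hh (by linarith)]
    simp
  have hGi : ContinuousOn G (uIcc r b) := by rwa [uIcc_of_le hrb.le]
  have e1 : (∫ ρ in r..b, deriv (cutoffProfile r h) ρ * G ρ) - G r =
      ∫ ρ in r..b, deriv (cutoffProfile r h) ρ * (G ρ - G r) := by
    simp only [mul_sub]
    rw [intervalIntegral.integral_sub, intervalIntegral.integral_mul_const, hint, one_mul]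
    · exact (hkc.continuousOn.mul hGi).intervalIntegrable
    · exact (hkc.mul continuous_const).intervalIntegrable _ _
  rw [Real.dist_eq, e1]
  have : ‖∫ ρ in r..b, deriv (cutoffProfile r h) ρ * (G ρ - G r)‖ ≤
      ∫ ρ in r..b, deriv (cutoffProfile r h) ρ * (ε / 2) := by
    refine intervalIntegral.norm_integral_le_of_norm_le hrb.le (ae_of_all _ fun ρ hρ => ?_)
      ((hkc.mul continuous_const).intervalIntegrable _ _)
    have hk0 := deriv_cutoffProfile_nonneg (r := r) hh (hr.trans hρ.1.le)
    rw [norm_mul, Real.norm_of_nonneg hk0]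
    by_cases hρb : ρ < b'
    · gcongr
      refine (hdG ⟨hρ.1.le, hρ.2⟩ ?_).le
      rw [Real.dist_eq, abs_of_pos (by linarith [hρ.1])]
      linarith [min_le_right b (r + d)]
    · rw [deriv_cutoffProfile_eq_zero hh (by nlinarith)]; simp
  rw [intervalIntegral.integral_mul_const, hint, one_mul] at this
  rw [Real.norm_eq_abs] at this
  linarith

/-- The open spherical shell with centre `c` and radii `a < b`. -/
def shell (c : E3) (a b : ℝ) : Set E3 := {y | ‖y - c‖ ∈ Ioo a b}

theorem measurableSet_shell (c : E3) (a b : ℝ) : MeasurableSet (shell c a b) :=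
  measurableSet_Ioo.preimage (by fun_prop)

theorem setIntegral_shell_radial_mul {c : E3} {r b : ℝ} (hr : 0 < r) (hrb : r < b) {k : ℝ → ℝ}
    (hk : Continuous k) {g : E3 → ℝ} (hg : ContinuousOn g {y | ‖y - c‖ ∈ Icc r b}) :
    ∫ y in shell c r b, k ‖y - c‖ * g y = ∫ ρ in r..b, k ρ * sphereIntegral c ρ g := by
  have hK : IsCompact {y : E3 | ‖y - c‖ ∈ Icc r b} := by
    refine Metric.isCompact_of_isClosed_isBounded ?_ ?_
    · exact isClosed_Icc.preimage (by fun_prop)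
    · refine (Metric.isBounded_closedBall (x := c) (r := b)).subset fun y hy => ?_
      rw [mem_closedBall_iff_norm]; exact hy.2
  have hsub : shell c r b ⊆ {y : E3 | ‖y - c‖ ∈ Icc r b} := fun y hy => Ioo_subset_Icc_self hy
  have hi : IntegrableOn (fun y => k ‖y - c‖ * g y) (shell c r b) := by
    refine (ContinuousOn.integrableOn_compact hK ?_).mono_set hsub
    exact (hk.comp (by fun_prop)).continuousOn.mul hg
  rw [← integral_indicator (measurableSet_shell c r b),
    integral_eq_integral_sphereIntegral c (hi.integrable_indicator (measurableSet_shell c r b)),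
    intervalIntegral.integral_of_le hrb.le, integral_Ioc_eq_integral_Ioo,
    ← integral_indicator measurableSet_Ioo, ← integral_indicator measurableSet_Ioi]
  congr 1
  ext ρ
  by_cases hρ0 : 0 < ρ
  · rw [indicator_of_mem (show ρ ∈ Ioi 0 from hρ0)]
    have hnorm : ∀ ω : Metric.sphere (0 : E3) 1, ‖c + ρ • (ω : E3) - c‖ = ρ := by
      intro ω; simp [norm_smul, abs_of_pos hρ0]
    by_cases hρ : ρ ∈ Ioo r b
    · rw [indicator_of_mem hρ]
      unfold sphereIntegral
      rw [mul_left_comm, ← integral_const_mul (k ρ)]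
      refine congrArg (ρ ^ 2 * ·) (integral_congr_ae (ae_of_all _ fun ω => ?_))
      beta_reduce
      rw [indicator_of_mem (by rw [shell, mem_ofPred_eq, hnorm ω]; exact hρ), hnorm ω]
    · rw [indicator_of_notMem hρ]
      unfold sphereIntegral
      have : ∀ ω : Metric.sphere (0 : E3) 1,
          (shell c r b).indicator (fun y => k ‖y - c‖ * g y) (c + ρ • (ω : E3)) = 0 := fun ω =>
        indicator_of_notMem (by rw [shell, mem_ofPred_eq, hnorm ω]; exact hρ) _
      simp [this]
  · rw [indicator_of_notMem (show ρ ∉ Ioi 0 from hρ0),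
      indicator_of_notMem (fun hh => hρ0 (hr.trans hh.1))]

theorem tendsto_setIntegral_shell {c : E3} {r b : ℝ} (hr : 0 < r) (hrb : r < b) {g : E3 → ℝ}
    (hg : ContinuousOn g {y | ‖y - c‖ ∈ Icc r b}) :
    Tendsto (fun h => ∫ y in shell c r b, deriv (cutoffProfile r h) ‖y - c‖ * g y) (𝓝[>] 0)
      (𝓝 (sphereIntegral c r g)) := by
  have := tendsto_integral_deriv_cutoffProfile_mul hr.le hrb (continuousOn_sphereIntegral hr.le hg)
  refine this.congr fun h => ?_
  rw [setIntegral_shell_radial_mul hr hrb ((contDiff_cutoffProfile r h).continuous_deriv le_rfl) hg]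

/-! ### Gradients of functions and of radial cutoffs -/

theorem continuousOn_gradient {f : E3 → ℝ} {U : Set E3} (hU : IsOpen U) (hf : ContDiffOn ℝ 1 f U) :
    ContinuousOn (gradient f) U :=
  (InnerProductSpace.toDual ℝ E3).symm.continuous.comp_continuousOn
    (hf.continuousOn_fderiv_of_isOpen hU le_rfl)

theorem continuousOn_gradientWithin {f : E3 → ℝ} {W : Set E3} (hW : UniqueDiffOn ℝ W)
    (hf : ContDiffOn ℝ 1 f W) : ContinuousOn (gradientWithin f W) W :=
  (InnerProductSpace.toDual ℝ E3).symm.continuous.comp_continuousOn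
    (hf.continuousOn_fderivWithin hW le_rfl)

theorem gradientWithin_of_mem_nhds {f : E3 → ℝ} {W : Set E3} {y : E3} (hW : W ∈ 𝓝 y) :
    gradientWithin f W y = gradient f y := by
  rw [gradientWithin, gradient, fderivWithin_of_mem_nhds hW]

theorem hasGradientAt_fun_mul {f g : E3 → ℝ} {f' g' y : E3} (hf : HasGradientAt f f' y)
    (hg : HasGradientAt g g' y) : HasGradientAt (fun z => f z * g z) (f y • g' + g y • f') y := by
  rw [hasGradientAt_iff_hasFDerivAt] at *
  refine (HasFDerivAt.fun_mul hf hg).congr_fderiv ?_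
  simp

/-- The profile depends on `ρ` only through `ρ ^ 2`, so there is no singularity at the centre. -/
theorem contDiff_cutoffProfile_norm_sub (r h : ℝ) (c : E3) :
    ContDiff ℝ 1 (fun y : E3 => cutoffProfile r h ‖y - c‖) := by
  unfold cutoffProfile
  refine Real.smoothTransition.contDiff.comp ?_
  exact ((((contDiff_id.sub contDiff_const).norm_sq ℝ).sub contDiff_const).div_const h).sub
    contDiff_const

theorem hasGradientAt_cutoffProfile_norm_sub (r h : ℝ) (c y : E3) :
    HasGradientAt (fun y : E3 => cutoffProfile r h ‖y - c‖)
      (deriv (cutoffProfile r h) ‖y - c‖ • (‖y - c‖⁻¹ • (y - c))) y := by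
  have h1 : HasFDerivAt (fun y : E3 => (‖y - c‖ ^ 2 - r ^ 2) / h - 1)
      ((2 / h) • (InnerProductSpace.toDual ℝ E3 (y - c))) y := by
    have h0 : HasFDerivAt (fun y : E3 => y - c) (ContinuousLinearMap.id ℝ E3) y :=
      (hasFDerivAt_id y).sub_const c
    have := ((h0.norm_sq.sub_const (r ^ 2)).mul_const h⁻¹).sub_const 1
    refine this.congr_fderiv ?_
    ext z
    simp
    ring
  have h2 : HasDerivAt Real.smoothTransition _ ((‖y - c‖ ^ 2 - r ^ 2) / h - 1) :=
    ((Real.smoothTransition.contDiff (n := 1)).differentiable (by simp) _).hasDerivAt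
  rw [hasGradientAt_iff_hasFDerivAt]
  refine (h2.comp_hasFDerivAt y h1).congr_fderiv ?_
  rw [deriv_cutoffProfile]
  -- At the centre both sides are zero; elsewhere the factor `ρ` of the profile's derivative cancels
  -- `‖y - c‖⁻¹`.
  rcases eq_or_ne (y - c) 0 with h0 | h0
  · simp [h0]
  · have h0 := norm_ne_zero_iff.2 h0
    simp only [map_smul, smul_smul]
    congr 1
    field_simp

theorem exists_abs_deriv_cutoffProfile_le (r : ℝ) {h : ℝ} (hh : 0 < h) :
    ∃ C, 0 ≤ C ∧ ∀ ρ, |deriv (cutoffProfile r h) ρ| ≤ C := by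
  have hc : Continuous (deriv (cutoffProfile r h)) :=
    (contDiff_cutoffProfile r h).continuous_deriv le_rfl
  -- Chosen so that `B ^ 2 > r ^ 2 + 2 * h`: beyond `B` the derivative vanishes.
  set B := |r| + 2 * h + 1
  have hB : 0 ≤ B := by positivity
  have h0B : (0 : ℝ) ∈ Icc (-B) B := ⟨neg_nonpos.2 hB, hB⟩
  obtain ⟨C, hC⟩ := (isCompact_Icc (a := -B) (b := B)).exists_bound_of_continuousOn hc.continuousOn
  refine ⟨C, (norm_nonneg _).trans (hC 0 h0B), fun ρ => ?_⟩
  by_cases hρ : |ρ| ≤ B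
  · exact hC ρ (abs_le.1 hρ)
  · have h0 : 0 ≤ C := (norm_nonneg _).trans (hC 0 h0B)
    rw [deriv_cutoffProfile_eq_zero hh, abs_zero]
    · exact h0
    · rw [← sq_abs ρ, ← sq_abs r]
      nlinarith [abs_nonneg r]

theorem norm_radial_le_one (c y : E3) : ‖‖y - c‖⁻¹ • (y - c)‖ ≤ 1 := by
  rw [norm_smul, norm_inv, norm_norm]
  exact inv_mul_le_one

/-! ### Energy identity in a perforated domain -/

section Perforated

variable {ι : Type*} {Ω : Set E3} {x : ι → E3} {r : ι → ℝ}

/-- The points of `Ω` outside all the balls except possibly the `i`-th. -/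
def outsideOthers (Ω : Set E3) (x : ι → E3) (r : ι → ℝ) (i : ι) : Set E3 :=
  Ω \ ⋃ j, ⋃ (_ : j ≠ i), Metric.closedBall (x j) (r j)

theorem closedBall_subset_outsideOthers
    (hsub : ∀ i, Metric.closedBall (x i) (r i) ⊆ Ω)
    (hdisj : ∀ i j, i ≠ j → Disjoint (Metric.closedBall (x i) (r i)) (Metric.closedBall (x j) (r j)))
    (i : ι) : Metric.closedBall (x i) (r i) ⊆ outsideOthers Ω x r i := by
  intro y hy
  refine ⟨hsub i hy, ?_⟩
  simp only [mem_iUnion, not_exists]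
  exact fun j hj hyj => (hdisj j i hj).le_bot ⟨hyj, hy⟩

theorem outsideOthers_diff_subset (i : ι) :
    outsideOthers Ω x r i \ Metric.ball (x i) (r i) ⊆ Ω \ ⋃ j, Metric.ball (x j) (r j) := by
  rintro y ⟨⟨hyΩ, hy⟩, hyi⟩
  refine ⟨hyΩ, ?_⟩
  simp only [mem_iUnion, not_exists] at hy ⊢
  intro j hj
  by_cases hji : j = i
  · subst hji; exact hyi hj
  · exact hy j hji (Metric.ball_subset_closedBall hj)

theorem outsideOthers_diff_closedBall_subset (i : ι) :
    outsideOthers Ω x r i \ Metric.closedBall (x i) (r i) ⊆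
      Ω \ ⋃ j, Metric.closedBall (x j) (r j) := by
  rintro y ⟨⟨hyΩ, hy⟩, hyi⟩
  refine ⟨hyΩ, ?_⟩
  simp only [mem_iUnion, not_exists] at hy ⊢
  intro j hj
  by_cases hji : j = i
  · subst hji; exact hyi hj
  · exact hy j hji hj

theorem diff_closedBalls_subset_diff_balls :
    Ω \ ⋃ j, Metric.closedBall (x j) (r j) ⊆ Ω \ ⋃ j, Metric.ball (x j) (r j) :=
  sdiff_subset_sdiff_right (iUnion_mono fun _ => Metric.ball_subset_closedBall)

variable [Fintype ι]

theorem isOpen_outsideOthers (hΩ : IsOpen Ω) (i : ι) : IsOpen (outsideOthers Ω x r i) := by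
  refine hΩ.sdiff (isClosed_iUnion_of_finite fun j => ?_)
  exact isClosed_iUnion_of_finite fun _ => Metric.isClosed_closedBall

theorem isOpen_diff_closedBalls (hΩ : IsOpen Ω) :
    IsOpen (Ω \ ⋃ j, Metric.closedBall (x j) (r j)) :=
  hΩ.sdiff (isClosed_iUnion_of_finite fun _ => Metric.isClosed_closedBall)

/-- A compact ball inside an open set has room around it. The radius `b` bounds the collar in which
the cutoff of ball `i` varies. -/
theorem exists_closedBall_subset_outsideOthers (hΩ : IsOpen Ω) (hr : ∀ i, 0 < r i)
    (hsub : ∀ i, Metric.closedBall (x i) (r i) ⊆ Ω)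
    (hdisj : ∀ i j, i ≠ j → Disjoint (Metric.closedBall (x i) (r i)) (Metric.closedBall (x j) (r j)))
    (i : ι) : ∃ b, r i < b ∧ Metric.closedBall (x i) b ⊆ outsideOthers Ω x r i := by
  obtain ⟨ε, hε, h⟩ := (isCompact_closedBall (x i) (r i)).exists_cthickening_subset_open
    (isOpen_outsideOthers hΩ i) (closedBall_subset_outsideOthers hsub hdisj i)
  rw [cthickening_closedBall hε.le (hr i).le] at h
  exact ⟨ε + r i, by linarith, h⟩

/-- At a point `y` of a boundary sphere, the half-space beyond the tangent plane is convex with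
interior and, by Cauchy–Schwarz, misses the open ball; near `y` it lies in the domain. Uniqueness of
derivatives makes `gradientWithin` continuous up to the spheres. -/
theorem uniqueDiffOn_diff_balls (hΩ : IsOpen Ω) (hr : ∀ i, 0 < r i)
    (hsub : ∀ i, Metric.closedBall (x i) (r i) ⊆ Ω)
    (hdisj : ∀ i j, i ≠ j →
      Disjoint (Metric.closedBall (x i) (r i)) (Metric.closedBall (x j) (r j))) :
    UniqueDiffOn ℝ (Ω \ ⋃ j, Metric.ball (x j) (r j)) := by
  intro y hy
  by_cases hP : y ∈ ⋃ j, Metric.closedBall (x j) (r j)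
  · obtain ⟨i, hi⟩ := mem_iUnion.1 hP
    have hyi : ‖y - x i‖ = r i := by
      refine le_antisymm (mem_closedBall_iff_norm.1 hi) ?_
      have := hy.2
      simp only [mem_iUnion, not_exists] at this
      exact not_lt.1 fun hlt => this i (mem_ball_iff_norm.2 hlt)
    set H : Set E3 := {z | r i ^ 2 ≤ inner ℝ (y - x i) (z - x i)}
    have hHo : IsOpen {z : E3 | r i ^ 2 < inner ℝ (y - x i) (z - x i)} :=
      isOpen_lt continuous_const (by fun_prop)
    have hconv : Convex ℝ H := by
      intro a ha b hb s t hs ht hst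
      have ha : r i ^ 2 ≤ inner ℝ (y - x i) (a - x i) := ha
      have hb : r i ^ 2 ≤ inner ℝ (y - x i) (b - x i) := hb
      have e : s • a + t • b - x i = s • (a - x i) + t • (b - x i) := by
        rw [smul_sub, smul_sub, sub_add_sub_comm, ← add_smul, hst, one_smul]
      show r i ^ 2 ≤ inner ℝ (y - x i) (s • a + t • b - x i)
      rw [e, inner_add_right, real_inner_smul_right, real_inner_smul_right]
      calc r i ^ 2 = s * r i ^ 2 + t * r i ^ 2 := by rw [← add_mul, hst, one_mul]
        _ ≤ _ := by gcongr
    have hint : (interior H).Nonempty := by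
      have hHs : {z : E3 | r i ^ 2 < inner ℝ (y - x i) (z - x i)} ⊆ H := by
        intro z hz
        have hz : r i ^ 2 < inner ℝ (y - x i) (z - x i) := hz
        exact hz.le
      refine ⟨x i + (2 : ℝ) • (y - x i), hHo.subset_interior_iff.2 hHs ?_⟩
      show r i ^ 2 < inner ℝ (y - x i) (x i + (2 : ℝ) • (y - x i) - x i)
      rw [add_sub_cancel_left, real_inner_smul_right, real_inner_self_eq_norm_sq, hyi]
      nlinarith [hr i]
    have hyH : y ∈ H := by
      show r i ^ 2 ≤ inner ℝ (y - x i) (y - x i)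
      rw [real_inner_self_eq_norm_sq, hyi]
    have hu := (uniqueDiffOn_convex hconv hint y hyH).inter
      ((isOpen_outsideOthers hΩ i).mem_nhds (closedBall_subset_outsideOthers hsub hdisj i hi))
    refine hu.mono fun z hz => outsideOthers_diff_subset i ⟨hz.2, fun hzb => ?_⟩
    have h1 : r i ^ 2 ≤ inner ℝ (y - x i) (z - x i) := hz.1
    have h2 := real_inner_le_norm (y - x i) (z - x i)
    rw [hyi] at h2
    rw [mem_ball_iff_norm] at hzb
    nlinarith [hr i]
  · exact uniqueDiffWithinAt_of_mem_nhds (mem_of_superset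
      ((isOpen_diff_closedBalls hΩ).mem_nhds ⟨hy.1, hP⟩) diff_closedBalls_subset_diff_balls)

/-- A smooth function that vanishes near the balls and is `1` away from them. -/
def multiCutoff (x : ι → E3) (r : ι → ℝ) (h : ℝ) (y : E3) : ℝ :=
  1 - ∑ i, (1 - cutoffProfile (r i) h ‖y - x i‖)

theorem contDiff_multiCutoff (h : ℝ) : ContDiff ℝ 1 (multiCutoff x r h) :=
  contDiff_const.sub (ContDiff.sum fun i _ =>
    contDiff_const.sub (contDiff_cutoffProfile_norm_sub (r i) h (x i)))

theorem hasGradientAt_multiCutoff (h : ℝ) (y : E3) : HasGradientAt (multiCutoff x r h)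
    (∑ i, deriv (cutoffProfile (r i) h) ‖y - x i‖ • (‖y - x i‖⁻¹ • (y - x i))) y := by
  have := fun i => hasGradientAt_iff_hasFDerivAt.1
    (hasGradientAt_cutoffProfile_norm_sub (r i) h (x i) y)
  rw [hasGradientAt_iff_hasFDerivAt]
  refine ((HasFDerivAt.fun_sum (u := Finset.univ)
    fun i _ => (this i).const_sub 1).const_sub 1).congr_fderiv ?_
  simp

/-- The transition collars of different balls may overlap, so the cutoff can be negative; this crude
bound, uniform in `h`, suffices for domination. -/
theorem abs_multiCutoff_le (h : ℝ) (y : E3) : |multiCutoff x r h y| ≤ 1 + Fintype.card ι := by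
  have h0 : 0 ≤ ∑ i, (1 - cutoffProfile (r i) h ‖y - x i‖) :=
    Finset.sum_nonneg fun i _ => sub_nonneg.2 (Real.smoothTransition.le_one _)
  have h1 : ∑ i, (1 - cutoffProfile (r i) h ‖y - x i‖) ≤ ∑ _i : ι, (1 : ℝ) :=
    Finset.sum_le_sum fun i _ => sub_le_self _ (Real.smoothTransition.nonneg _)
  simp only [Finset.sum_const, Finset.card_univ, nsmul_eq_mul, mul_one] at h1
  unfold multiCutoff
  rw [abs_le]
  constructor <;> linarith

theorem tendsto_multiCutoff (hr : ∀ i, 0 < r i) {y : E3}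
    (hy : y ∉ ⋃ j, Metric.closedBall (x j) (r j)) :
    Tendsto (fun h => multiCutoff x r h y) (𝓝[>] 0) (𝓝 1) := by
  have : ∀ᶠ h in 𝓝[>] (0 : ℝ), ∀ i, r i ^ 2 + 2 * h < ‖y - x i‖ ^ 2 := by
    refine eventually_all.2 fun i => ?_
    have hyi : r i < ‖y - x i‖ := by
      simp only [mem_iUnion, not_exists, mem_closedBall_iff_norm, not_le] at hy
      exact hy i
    have : Tendsto (fun h : ℝ => r i ^ 2 + 2 * h) (𝓝[>] 0) (𝓝 (r i ^ 2 + 2 * 0)) :=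
      (Continuous.tendsto (by fun_prop) _).mono_left nhdsWithin_le_nhds
    refine this.eventually (gt_mem_nhds ?_)
    nlinarith [hr i]
  refine tendsto_const_nhds.congr' ?_
  filter_upwards [this, self_mem_nhdsWithin] with h hs hh
  simp [multiCutoff, fun i => cutoffProfile_eq_one (show 0 < h from hh) (hs i).le]

/-- Near ball `i` its own profile is `0`, while every other profile is already `1` because the point
lies outside the larger ball of radius `b j`. -/
theorem multiCutoff_eq_zero {h : ℝ} (hh : 0 < h) {b : ι → ℝ} (hb0 : ∀ i, 0 < b i)
    (hb : ∀ i, Metric.closedBall (x i) (b i) ⊆ outsideOthers Ω x r i)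
    (hhb : ∀ i, r i ^ 2 + 2 * h < b i ^ 2) :
    ∃ U, IsOpen U ∧ (⋃ j, Metric.closedBall (x j) (r j)) ⊆ U ∧ ∀ y ∈ U, multiCutoff x r h y = 0 := by
  refine ⟨⋃ i, {y | ‖y - x i‖ ^ 2 < r i ^ 2 + h} ∩ ⋂ j, ⋂ (_ : j ≠ i),
    (Metric.closedBall (x j) (b j))ᶜ, ?_, ?_, ?_⟩
  · refine isOpen_iUnion fun i => IsOpen.inter (isOpen_lt (by fun_prop) continuous_const) ?_
    refine isOpen_iInter_of_finite fun j => isOpen_iInter_of_finite fun _ => ?_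
    exact Metric.isClosed_closedBall.isOpen_compl
  · refine iUnion_mono fun i y hy => ⟨?_, ?_⟩
    · have : ‖y - x i‖ ≤ r i := mem_closedBall_iff_norm.1 hy
      have := pow_le_pow_left₀ (norm_nonneg _) this 2
      show ‖y - x i‖ ^ 2 < r i ^ 2 + h
      linarith
    · simp only [mem_iInter]
      intro j hj hyj
      have := (hb j hyj).2
      simp only [mem_iUnion, not_exists] at this
      exact this i hj.symm hy
  · intro y hy
    obtain ⟨i, hyi, hyj⟩ := mem_iUnion.1 hy
    simp only [mem_iInter] at hyj
    have h1 : ∀ j ≠ i, 1 - cutoffProfile (r j) h ‖y - x j‖ = 0 := by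
      intro j hj
      have := hyj j hj
      rw [mem_compl_iff, mem_closedBall_iff_norm, not_le] at this
      have := pow_le_pow_left₀ (hb0 j).le this.le 2
      rw [cutoffProfile_eq_one hh (by linarith [hhb j]), sub_self]
    rw [multiCutoff, Finset.sum_eq_single i (fun j _ hj => h1 j hj) (by simp),
      cutoffProfile_eq_zero hh (le_of_lt hyi)]
    simp

/-- Testing the weak no-flux condition with `multiCutoff x r h * v`. -/
theorem integral_multiCutoff_mul_norm_gradient_sq (hΩ : IsOpen Ω) (hr : ∀ i, 0 < r i) {v : E3 → ℝ}
    (hv : ContDiffOn ℝ 1 v (Ω \ ⋃ j, Metric.closedBall (x j) (r j)))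
    (hv2 : IntegrableOn (fun y => v y ^ 2) (Ω \ ⋃ j, Metric.closedBall (x j) (r j)))
    (hg2 : IntegrableOn (fun y => ‖gradient v y‖ ^ 2) (Ω \ ⋃ j, Metric.closedBall (x j) (r j)))
    (hno : NoFluxOuter Ω (⋃ j, Metric.closedBall (x j) (r j)) v)
    {b : ι → ℝ} (hrb : ∀ i, r i < b i)
    (hb : ∀ i, Metric.closedBall (x i) (b i) ⊆ outsideOthers Ω x r i)
    {h : ℝ} (hh : 0 < h) (hhb : ∀ i, r i ^ 2 + 2 * h < b i ^ 2) :
    ∫ y in Ω \ ⋃ j, Metric.closedBall (x j) (r j), multiCutoff x r h y * ‖gradient v y‖ ^ 2 =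
      -∑ i, ∫ y in shell (x i) (r i) (b i), deriv (cutoffProfile (r i) h) ‖y - x i‖ *
        (v y * inner ℝ (gradient v y) (‖y - x i‖⁻¹ • (y - x i))) := by
  set P : Set E3 := ⋃ j, Metric.closedBall (x j) (r j) with hP
  have hUo : IsOpen (Ω \ P) := isOpen_diff_closedBalls hΩ
  have hUm := hUo.measurableSet
  obtain ⟨V, hVo, hPV, hV0⟩ := multiCutoff_eq_zero hh (fun i => (hr i).trans (hrb i)) hb hhb
  set χ : E3 → ℝ := multiCutoff x r h with hχ
  set k : ι → E3 → ℝ := fun i y => deriv (cutoffProfile (r i) h) ‖y - x i‖ with hk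
  set n : ι → E3 → E3 := fun i y => ‖y - x i‖⁻¹ • (y - x i) with hn
  set χ' : E3 → E3 := fun y => ∑ i, k i y • n i y with hχ'
  have hχgrad : ∀ y, HasGradientAt χ (χ' y) y := fun y => hasGradientAt_multiCutoff h y
  have hχC : ContDiff ℝ 1 χ := contDiff_multiCutoff h
  have hχ'C : Continuous χ' := by
    have := continuousOn_gradient isOpen_univ hχC.contDiffOn
    rw [← continuousOn_univ]
    exact this.congr fun y _ => (hχgrad y).gradient.symm
  choose C hC0 hC using fun i => exists_abs_deriv_cutoffProfile_le (r i) hh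
  have hn1 : ∀ i y, ‖n i y‖ ≤ 1 := fun i y => norm_radial_le_one _ _
  have hχ'b : ∀ y, ‖χ' y‖ ≤ ∑ i, C i := by
    intro y
    refine (norm_sum_le _ _).trans (Finset.sum_le_sum fun i _ => ?_)
    rw [norm_smul]
    calc ‖k i y‖ * ‖n i y‖ ≤ C i * 1 := by
          gcongr
          · exact hC0 i
          · exact hC i _
          · exact hn1 i y
      _ = C i := mul_one _
  set M : ℝ := 1 + Fintype.card ι
  have hχb : ∀ y, |χ y| ≤ M := abs_multiCutoff_le h
  have hM0 : 0 ≤ M := by positivity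
  set φ : E3 → ℝ := fun y => χ y * v y with hφ
  have hvgrad : ∀ y ∈ Ω \ P, HasGradientAt v (gradient v y) y := fun y hy =>
    ((hv.differentiableOn (by simp)).differentiableAt (hUo.mem_nhds hy)).hasGradientAt
  have hφgrad : ∀ y ∈ Ω \ P, gradient φ y = χ y • gradient v y + v y • χ' y := fun y hy =>
    (hasGradientAt_fun_mul (hχgrad y) (hvgrad y hy)).gradient
  have hφV : ∀ y ∈ V, φ y = 0 := fun y hy => by simp [hφ, hV0 y hy]
  have hφV' : ∀ y ∈ V, φ =ᶠ[𝓝 y] fun _ => 0 := fun y hy =>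
    mem_of_superset (hVo.mem_nhds hy) hφV
  -- Nothing is known of `v` inside the particles, but there `φ` is locally zero.
  have hφC : ContDiffOn ℝ 1 φ Ω := by
    intro y hy
    by_cases hyP : y ∈ P
    · exact (contDiffAt_const.congr_of_eventuallyEq (hφV' y (hPV hyP))).contDiffWithinAt
    · exact (hχC.contDiffAt.mul (hv.contDiffAt (hUo.mem_nhds ⟨hy, hyP⟩))).contDiffWithinAt
  have hvc : ContinuousOn v (Ω \ P) := hv.continuousOn
  have hgc : ContinuousOn (gradient v) (Ω \ P) := continuousOn_gradient hUo hv
  have hφ2 : IntegrableOn (fun y => φ y ^ 2) Ω := by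
    have : IntegrableOn (fun y => φ y ^ 2) (Ω \ P) := by
      refine Integrable.mono' (hv2.const_mul (M ^ 2)) ?_ (ae_of_all _ fun y => ?_)
      · exact ((hφC.continuousOn.mono sdiff_subset).pow 2).aestronglyMeasurable hUm
      · rw [Real.norm_of_nonneg (sq_nonneg _), hφ]
        simp only [mul_pow]
        refine mul_le_mul_of_nonneg_right ?_ (sq_nonneg _)
        exact sq_le_sq' (abs_le.1 (hχb y)).1 (abs_le.1 (hχb y)).2
    refine this.of_forall_sdiff_eq_zero hΩ.measurableSet fun y hy => ?_
    have hyP : y ∈ P := by by_contra hyP; exact hy.2 ⟨hy.1, hyP⟩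
    simp [hφV y (hPV hyP)]
  have hφg2 : IntegrableOn (fun y => ‖gradient φ y‖ ^ 2) Ω := by
    have : IntegrableOn (fun y => ‖gradient φ y‖ ^ 2) (Ω \ P) := by
      refine Integrable.mono' ((hg2.const_mul (2 * M ^ 2)).add
        (hv2.const_mul (2 * (∑ i, C i) ^ 2))) ?_ ?_
      · exact (((continuousOn_gradient hΩ hφC).mono sdiff_subset).norm.pow 2).aestronglyMeasurable hUm
      · filter_upwards [ae_restrict_mem hUm] with y hy
        rw [Real.norm_of_nonneg (sq_nonneg _), hφgrad y hy]
        have h1 : ‖χ y • gradient v y + v y • χ' y‖ ≤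
            M * ‖gradient v y‖ + |v y| * ∑ i, C i := by
          refine (norm_add_le _ _).trans ?_
          rw [norm_smul, norm_smul, Real.norm_eq_abs, Real.norm_eq_abs]
          gcongr
          · exact hχb y
          · exact hχ'b y
        refine (pow_le_pow_left₀ (norm_nonneg _) h1 2).trans ?_
        simp only [Pi.add_apply]
        rw [← sq_abs (v y)]
        nlinarith [sq_nonneg (M * ‖gradient v y‖ - |v y| * ∑ i, C i)]
    refine this.of_forall_sdiff_eq_zero hΩ.measurableSet fun y hy => ?_
    have hyP : y ∈ P := by by_contra hyP; exact hy.2 ⟨hy.1, hyP⟩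
    simp [(hφV' y (hPV hyP)).gradient_eq]
  have key := hno φ hφC ⟨V, hVo, hPV, hφV⟩ hφ2 hφg2
  have e1 : ∀ y ∈ Ω \ P, inner ℝ (gradient v y) (gradient φ y) =
      χ y * ‖gradient v y‖ ^ 2 + ∑ i, k i y * (v y * inner ℝ (gradient v y) (n i y)) := by
    intro y hy
    rw [hφgrad y hy, inner_add_right, real_inner_smul_right, real_inner_smul_right,
      real_inner_self_eq_norm_sq, hχ', inner_sum, Finset.mul_sum]
    congr 1
    refine Finset.sum_congr rfl fun i _ => ?_
    rw [real_inner_smul_right]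
    ring
  have hi0 : IntegrableOn (fun y => χ y * ‖gradient v y‖ ^ 2) (Ω \ P) := by
    refine Integrable.mono' (hg2.const_mul M) ?_ (ae_of_all _ fun y => ?_)
    · exact (hχC.continuous.continuousOn.mul (hgc.norm.pow 2)).aestronglyMeasurable hUm
    · rw [norm_mul, Real.norm_of_nonneg (sq_nonneg _), Real.norm_eq_abs]
      gcongr
      exact hχb y
  have hkm : ∀ i, Measurable (k i) := fun i =>
    (measurable_deriv _).comp (by fun_prop)
  have hnm : ∀ i, Measurable (n i) := fun i => by fun_prop
  have hi1 : ∀ i, IntegrableOn (fun y => k i y * (v y * inner ℝ (gradient v y) (n i y)))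
      (Ω \ P) := by
    intro i
    refine Integrable.mono' ((hv2.add hg2).const_mul (C i)) ?_ (ae_of_all _ fun y => ?_)
    · refine (hkm i).aestronglyMeasurable.mul ((hvc.aestronglyMeasurable hUm).mul ?_)
      exact (hgc.aestronglyMeasurable hUm).inner (hnm i).aestronglyMeasurable
    · have h1 : |inner ℝ (gradient v y) (n i y)| ≤ ‖gradient v y‖ * 1 :=
        (abs_real_inner_le_norm _ _).trans (by gcongr; exact hn1 i y)
      rw [norm_mul, Real.norm_eq_abs, norm_mul, Real.norm_eq_abs, Real.norm_eq_abs]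
      simp only [Pi.add_apply]
      refine mul_le_mul (hC i _) ?_ (by positivity) (hC0 i)
      calc |v y| * |inner ℝ (gradient v y) (n i y)| ≤ |v y| * (‖gradient v y‖ * 1) := by gcongr
        _ ≤ v y ^ 2 + ‖gradient v y‖ ^ 2 := by
          rw [← sq_abs (v y)]
          nlinarith [sq_nonneg (|v y| - ‖gradient v y‖), sq_nonneg (|v y|),
            sq_nonneg ‖gradient v y‖]
  rw [setIntegral_congr_fun hUm e1, integral_add hi0 (integrable_finsetSum _ fun i _ => hi1 i),
    integral_finsetSum _ fun i _ => hi1 i] at key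
  rw [eq_neg_iff_add_eq_zero, ← key]
  congr 1
  refine Finset.sum_congr rfl fun i _ => ?_
  symm
  -- The `i`-th shell lies in the perforated domain and `k i` vanishes off it.
  refine setIntegral_eq_of_subset_of_forall_sdiff_eq_zero hUm (fun y hy => ?_) fun y hy => ?_
  · refine outsideOthers_diff_closedBall_subset i ⟨hb i ?_, ?_⟩
    · exact mem_closedBall_iff_norm.2 (le_of_lt hy.2)
    · rw [mem_closedBall_iff_norm, not_le]; exact hy.1
  · have hk0 : k i y = 0 := by
      by_cases hyr : r i < ‖y - x i‖
      · have : b i ≤ ‖y - x i‖ := not_lt.1 fun hlt => hy.2 ⟨hyr, hlt⟩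
        refine deriv_cutoffProfile_eq_zero hh ((hhb i).trans_le ?_)
        exact pow_le_pow_left₀ ((hr i).trans (hrb i)).le this 2
      · refine deriv_cutoffProfile_eq_zero' hh ?_
        have := pow_le_pow_left₀ (norm_nonneg _) (not_lt.1 hyr) 2
        linarith
    simp [hk0]

/-- The energy identity for a function in a perforated domain that is constant on each inner
boundary sphere and has no flux through the outer boundary. -/
theorem integral_norm_gradient_sq_eq_neg_sum (hΩ : IsOpen Ω) (hr : ∀ i, 0 < r i)
    (hsub : ∀ i, Metric.closedBall (x i) (r i) ⊆ Ω)
    (hdisj : ∀ i j, i ≠ j →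
      Disjoint (Metric.closedBall (x i) (r i)) (Metric.closedBall (x j) (r j)))
    {v : E3 → ℝ} {c : ι → ℝ}
    (hv : ContDiffOn ℝ 1 v (Ω \ ⋃ j, Metric.ball (x j) (r j)))
    (hv2 : IntegrableOn (fun y => v y ^ 2) (Ω \ ⋃ j, Metric.closedBall (x j) (r j)))
    (hg2 : IntegrableOn (fun y => ‖gradient v y‖ ^ 2) (Ω \ ⋃ j, Metric.closedBall (x j) (r j)))
    (hc : ∀ i, ∀ y ∈ Metric.sphere (x i) (r i), v y = c i)
    (hno : NoFluxOuter Ω (⋃ j, Metric.closedBall (x j) (r j)) v) :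
    ∫ y in Ω \ ⋃ j, Metric.closedBall (x j) (r j), ‖gradient v y‖ ^ 2 =
      -∑ i, c i * sphereIntegral (x i) (r i) fun y =>
        inner ℝ (gradientWithin v (Ω \ ⋃ j, Metric.ball (x j) (r j)) y)
          (‖y - x i‖⁻¹ • (y - x i)) := by
  have hW := uniqueDiffOn_diff_balls hΩ hr hsub hdisj
  have hUo : IsOpen (Ω \ ⋃ j, Metric.closedBall (x j) (r j)) := isOpen_diff_closedBalls hΩ
  choose b hrb hb using exists_closedBall_subset_outsideOthers hΩ hr hsub hdisj
  have hvU := hv.mono diff_closedBalls_subset_diff_balls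
  -- The one-sided gradient makes `G i` continuous up to the inner sphere; in the open domain it is
  -- the ordinary gradient.
  set G : ι → E3 → ℝ := fun i y => v y *
    inner ℝ (gradientWithin v (Ω \ ⋃ j, Metric.ball (x j) (r j)) y) (‖y - x i‖⁻¹ • (y - x i))
  have hann : ∀ i, {y | ‖y - x i‖ ∈ Icc (r i) (b i)} ⊆ Ω \ ⋃ j, Metric.ball (x j) (r j) := by
    intro i y hy
    refine outsideOthers_diff_subset i ⟨hb i (mem_closedBall_iff_norm.2 hy.2), ?_⟩
    rw [mem_ball_iff_norm, not_lt]; exact hy.1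
  have hG : ∀ i, ContinuousOn (G i) {y | ‖y - x i‖ ∈ Icc (r i) (b i)} := by
    intro i
    have hn : ContinuousOn (fun y => ‖y - x i‖⁻¹ • (y - x i)) {y | ‖y - x i‖ ∈ Icc (r i) (b i)} := by
      have hd : ContinuousOn (fun y => y - x i) {y | ‖y - x i‖ ∈ Icc (r i) (b i)} := by fun_prop
      exact (hd.norm.inv₀ fun y hy => ((hr i).trans_le hy.1).ne').smul hd
    exact (hv.continuousOn.mono (hann i)).mul
      (((continuousOn_gradientWithin hW hv).mono (hann i)).inner hn)
  have hlimR : Tendsto (fun h => -∑ i, ∫ y in shell (x i) (r i) (b i),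
      deriv (cutoffProfile (r i) h) ‖y - x i‖ * G i y) (𝓝[>] 0)
      (𝓝 (-∑ i, sphereIntegral (x i) (r i) (G i))) :=
    (tendsto_finsetSum _ fun i _ => tendsto_setIntegral_shell (hr i) (hrb i) (hG i)).neg
  have hlimL : Tendsto (fun h => ∫ y in Ω \ ⋃ j, Metric.closedBall (x j) (r j),
      multiCutoff x r h y * ‖gradient v y‖ ^ 2) (𝓝[>] 0)
      (𝓝 (∫ y in Ω \ ⋃ j, Metric.closedBall (x j) (r j), ‖gradient v y‖ ^ 2)) := by
    refine tendsto_integral_filter_of_dominated_convergence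
      (fun y => (1 + Fintype.card ι) * ‖gradient v y‖ ^ 2) ?_ ?_ (hg2.const_mul _) ?_
    · exact Eventually.of_forall fun h => ((contDiff_multiCutoff h).continuous.continuousOn.mul
        ((continuousOn_gradient hUo hvU).norm.pow 2)).aestronglyMeasurable hUo.measurableSet
    · refine Eventually.of_forall fun h => ae_of_all _ fun y => ?_
      rw [norm_mul, Real.norm_of_nonneg (sq_nonneg _), Real.norm_eq_abs]
      gcongr
      exact abs_multiCutoff_le h y
    · filter_upwards [ae_restrict_mem hUo.measurableSet] with y hy
      simpa using (tendsto_multiCutoff hr hy.2).mul_const (‖gradient v y‖ ^ 2)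
  have hev : ∀ᶠ h in 𝓝[>] (0 : ℝ), ∀ i, r i ^ 2 + 2 * h < b i ^ 2 := by
    refine eventually_all.2 fun i => ?_
    have : Tendsto (fun h : ℝ => r i ^ 2 + 2 * h) (𝓝[>] 0) (𝓝 (r i ^ 2 + 2 * 0)) :=
      (Continuous.tendsto (by fun_prop) _).mono_left nhdsWithin_le_nhds
    refine this.eventually (gt_mem_nhds ?_)
    nlinarith [hr i, hrb i]
  have heq : ∀ᶠ h in 𝓝[>] (0 : ℝ), (-∑ i, ∫ y in shell (x i) (r i) (b i),
      deriv (cutoffProfile (r i) h) ‖y - x i‖ * G i y) =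
      ∫ y in Ω \ ⋃ j, Metric.closedBall (x j) (r j), multiCutoff x r h y * ‖gradient v y‖ ^ 2 := by
    filter_upwards [hev, self_mem_nhdsWithin] with h hhb hh
    rw [integral_multiCutoff_mul_norm_gradient_sq hΩ hr hvU hv2 hg2 hno hrb hb hh hhb]
    congr 1
    refine Finset.sum_congr rfl fun i _ => ?_
    refine setIntegral_congr_fun (measurableSet_shell _ _ _) fun y hy => ?_
    have hyU : y ∈ Ω \ ⋃ j, Metric.closedBall (x j) (r j) := by
      refine outsideOthers_diff_closedBall_subset i ⟨hb i ?_, ?_⟩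
      · exact mem_closedBall_iff_norm.2 (le_of_lt hy.2)
      · rw [mem_closedBall_iff_norm, not_le]; exact hy.1
    simp only [G]
    rw [gradientWithin_of_mem_nhds
      (mem_of_superset (hUo.mem_nhds hyU) diff_closedBalls_subset_diff_balls)]
  rw [tendsto_nhds_unique hlimL (hlimR.congr' heq)]
  congr 1
  refine Finset.sum_congr rfl fun i _ => ?_
  unfold sphereIntegral
  rw [mul_left_comm, ← integral_const_mul (c i)]
  refine congrArg (r i ^ 2 * ·) (integral_congr_ae (ae_of_all _ fun ω => ?_))
  simp only [G]
  rw [hc i]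
  simp [norm_smul, abs_of_pos (hr i)]

end Perforated

/-! ### Evolution in time -/

/-- Induction on the exceptional set: split the interval at an exceptional point and glue the two
halves, which share that endpoint. -/
theorem antitoneOn_of_hasDerivAt_nonpos_off_finset {f f' : ℝ → ℝ} (F : Finset ℝ) {a b : ℝ}
    (hc : ContinuousOn f (Icc a b)) (hd : ∀ s ∈ Ioo a b, s ∉ F → HasDerivAt f (f' s) s)
    (hf' : ∀ s ∈ Ioo a b, s ∉ F → f' s ≤ 0) : AntitoneOn f (Icc a b) := by
  induction F using Finset.induction_on generalizing a b with
  | empty =>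
    refine antitoneOn_of_deriv_nonpos (convex_Icc a b) hc ?_ ?_
    · rw [interior_Icc]
      exact fun s hs => (hd s hs (by simp)).differentiableAt.differentiableWithinAt
    · rw [interior_Icc]
      intro s hs
      rw [(hd s hs (by simp)).deriv]
      exact hf' s hs (by simp)
  | insert p F hp ih =>
    by_cases hpm : p ∈ Ioo a b
    · have h1 : AntitoneOn f (Icc a p) := by
        refine ih (hc.mono (Icc_subset_Icc le_rfl hpm.2.le)) ?_ ?_
        · exact fun s hs hsF => hd s ⟨hs.1, hs.2.trans hpm.2⟩ (by simp [hsF, hs.2.ne])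
        · exact fun s hs hsF => hf' s ⟨hs.1, hs.2.trans hpm.2⟩ (by simp [hsF, hs.2.ne])
      have h2 : AntitoneOn f (Icc p b) := by
        refine ih (hc.mono (Icc_subset_Icc hpm.1.le le_rfl)) ?_ ?_
        · exact fun s hs hsF => hd s ⟨hpm.1.trans hs.1, hs.2⟩ (by simp [hsF, hs.1.ne'])
        · exact fun s hs hsF => hf' s ⟨hpm.1.trans hs.1, hs.2⟩ (by simp [hsF, hs.1.ne'])
      have := h1.union_right h2 (isGreatest_Icc hpm.1.le) (isLeast_Icc hpm.2.le)
      rwa [Icc_union_Icc_eq_Icc hpm.1.le hpm.2.le] at this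
    · refine ih hc ?_ ?_
      · intro s hs hsF
        refine hd s hs ?_
        rw [Finset.mem_insert, not_or]
        exact ⟨fun h => hpm (h ▸ hs), hsF⟩
      · intro s hs hsF
        refine hf' s hs ?_
        rw [Finset.mem_insert, not_or]
        exact ⟨fun h => hpm (h ▸ hs), hsF⟩

theorem setOf_biUnion_eq_iUnion_subtype {N : ℕ} (p : Fin N → Prop) (B : Fin N → Set E3) :
    ⋃ i ∈ {i | p i}, B i = ⋃ i : {i // p i}, B i := by
  ext y; simp

namespace IsSolution

variable {N : ℕ} {Ω : Set E3} {δ α T : ℝ} {x : Fin N → E3} {R : Fin N → ℝ → ℝ} {u : ℝ → E3 → ℝ}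

/-- The growth law covers active particles; an extinct one has radius identically zero near any time
strictly after its extinction. -/
theorem hasDerivAt_radius (h : IsSolution Ω δ α T x R u) {s : ℝ} (hs : s ∈ Ioo 0 T)
    (hne : ∀ j, s ≠ extinctionTime T R j) (i : Fin N) : HasDerivAt (R i) (deriv (R i) s) s := by
  by_cases hi : 0 < R i s
  · exact (h.growth s hs hne i hi).differentiableAt.hasDerivAt
  · have hs0 : R i s = 0 := le_antisymm (not_lt.1 hi) (h.nonneg i s ⟨hs.1.le, hs.2⟩)
    have hle : extinctionTime T R i ≤ s := by
      refine csSup_le ⟨0, ⟨le_rfl, hs.1.trans hs.2⟩, h.initial_pos i⟩ fun t ht => ?_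
      by_contra hlt
      exact ht.2.ne' (h.extinct i s ⟨hs.1.le, hs.2⟩ t ht.1 (not_le.1 hlt).le hs0)
    have hlt : extinctionTime T R i < s := lt_of_le_of_ne hle (hne i).symm
    have hbdd : BddAbove {t : ℝ | t ∈ Ico 0 T ∧ 0 < R i t} := ⟨T, fun t ht => ht.1.2.le⟩
    have hpos : 0 ≤ extinctionTime T R i :=
      le_csSup hbdd ⟨⟨le_rfl, hs.1.trans hs.2⟩, h.initial_pos i⟩
    have hev : R i =ᶠ[𝓝 s] fun _ => 0 := by
      filter_upwards [Ioo_mem_nhds hlt hs.2] with t ht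
      have htT : t ∈ Ico 0 T := ⟨hpos.trans ht.1.le, ht.2⟩
      refine le_antisymm (not_lt.1 fun hR => ?_) (h.nonneg i t htT)
      exact (le_csSup hbdd ⟨htT, hR⟩).not_gt ht.1
    exact (hev.differentiableAt_iff.2 (differentiableAt_const 0)).hasDerivAt

theorem dirichletEnergy_eq (h : IsSolution Ω δ α T x R u) (hΩ : IsOpen Ω) (hδ : 0 < δ) {s : ℝ}
    (hs : s ∈ Ioo 0 T) (hne : ∀ j, s ≠ extinctionTime T R j) :
    dirichletEnergy Ω δ α x R u s = 4 * Real.pi * δ ^ (2 * α) *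
      -∑ i, (R i s * deriv (R i) s + R i s ^ 2 * |deriv (R i) s| ^ 2) := by
  have hp := h.potential s hs hne
  have hs' : s ∈ Ico 0 T := ⟨hs.1.le, hs.2⟩
  have hδα : 0 < δ ^ α := Real.rpow_pos_of_pos hδ α
  have hδ2 : 0 < δ ^ (2 * α) := Real.rpow_pos_of_pos hδ _
  have e1 : particles δ α x R s =
      ⋃ i : {i // 0 < R i s}, Metric.closedBall (x i) (δ ^ α * R i s) :=
    setOf_biUnion_eq_iUnion_subtype _ _
  have e2 : bulk Ω δ α x R s =
      Ω \ ⋃ i : {i // 0 < R i s}, Metric.closedBall (x i) (δ ^ α * R i s) := by rw [bulk, e1]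
  have e3 : bulkWithSpheres Ω δ α x R s =
      Ω \ ⋃ i : {i // 0 < R i s}, Metric.ball (x i) (δ ^ α * R i s) :=
    congrArg (Ω \ ·) (setOf_biUnion_eq_iUnion_subtype _ _)
  -- The index type consists of the active particles, so all radii are positive.
  have key := integral_norm_gradient_sq_eq_neg_sum hΩ (ι := {i // 0 < R i s})
    (x := fun i => x i) (r := fun i => δ ^ α * R i s) (v := u s)
    (c := fun i => 1 / R i s + deriv (R i) s) (fun i => mul_pos hδα i.2)
    (fun i => h.particle_subset s hs' i i.2)
    (fun i j hij => h.particle_disjoint s hs' i j (fun e => hij (Subtype.ext e)) i.2 j.2)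
    (e3 ▸ hp.contDiffOn) (e2 ▸ hp.sq_integrable) (e2 ▸ hp.grad_sq_integrable)
    (fun i => hp.gibbsThomson i i.2) (e1 ▸ hp.noFlux)
  rw [dirichletEnergy, e2, key, mul_neg, neg_inj, Finset.mul_sum]
  have hflux : ∀ i : {i // 0 < R i s}, (1 / R i s + deriv (R i) s) *
      particleFlux Ω δ α x R s (u s) i = 4 * Real.pi * δ ^ (2 * α) *
        (R i s * deriv (R i) s + R i s ^ 2 * |deriv (R i) s| ^ 2) := by
    intro i
    have hi := i.2
    rw [sq_abs, (h.growth s hs hne i i.2).deriv]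
    have := Real.pi_pos
    field_simp
  -- Extinct particles contribute nothing, so the sum extends to all indices.
  have hzero : ∀ i, ¬ 0 < R i s → 4 * Real.pi * δ ^ (2 * α) *
        (R i s * deriv (R i) s + R i s ^ 2 * |deriv (R i) s| ^ 2) = 0 := by
    intro i hi
    rw [le_antisymm (not_lt.1 hi) (h.nonneg i s hs')]
    simp
  refine Eq.trans ?_ (Fintype.sum_subtype_add_sum_subtype (fun i => 0 < R i s) _)
  refine Eq.trans ?_ (congrArg _ (Finset.sum_eq_zero fun i _ => hzero i.1 i.2).symm)
  rw [add_zero]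
  refine Finset.sum_congr rfl fun i _ => ?_
  rw [← hflux i, particleFlux, e3]

theorem hasDerivAt_half_sum_sq (h : IsSolution Ω δ α T x R u) {s : ℝ}
    (hs : s ∈ Ioo 0 T) (hne : ∀ j, s ≠ extinctionTime T R j) :
    HasDerivAt (fun s => 1 / 2 * ∑ i, R i s ^ 2) (∑ i, R i s * deriv (R i) s) s := by
  refine ((HasDerivAt.fun_sum (u := Finset.univ) fun i _ =>
    (h.hasDerivAt_radius hs hne i).fun_pow 2).const_mul (1 / 2)).congr_deriv ?_
  rw [Finset.mul_sum]
  refine Finset.sum_congr rfl fun i _ => ?_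
  push_cast
  ring

/-- The Dirichlet energy is nonnegative. This gives both monotonicity of `½ ∑ R²` and the dominating
function for the kinetic terms. -/
theorem sum_sq_mul_sq_le (h : IsSolution Ω δ α T x R u) (hΩ : IsOpen Ω) (hδ : 0 < δ) {s : ℝ}
    (hs : s ∈ Ioo 0 T) (hne : ∀ j, s ≠ extinctionTime T R j) :
    ∑ i, R i s ^ 2 * |deriv (R i) s| ^ 2 ≤ -∑ i, R i s * deriv (R i) s := by
  have hD : 0 ≤ dirichletEnergy Ω δ α x R u s := integral_nonneg fun y => sq_nonneg _
  rw [h.dirichletEnergy_eq hΩ hδ hs hne, Finset.sum_add_distrib] at hD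
  have hK : 0 < 4 * Real.pi * δ ^ (2 * α) := by
    have := Real.rpow_pos_of_pos hδ (2 * α)
    have := Real.pi_pos
    positivity
  have := (mul_nonneg_iff_of_pos_left hK).1 hD
  linarith

theorem continuousOn_half_sum_sq (h : IsSolution Ω δ α T x R u) :
    ContinuousOn (fun s => 1 / 2 * ∑ i, R i s ^ 2) (Ico 0 T) :=
  continuousOn_const.mul (continuousOn_finsetSum _ fun i _ => (h.continuousOn i).pow 2)

theorem antitoneOn_half_sum_sq (h : IsSolution Ω δ α T x R u) (hΩ : IsOpen Ω) (hδ : 0 < δ) :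
    AntitoneOn (fun s => 1 / 2 * ∑ i, R i s ^ 2) (Ico 0 T) := by
  classical
  intro a ha b hb hab
  have hne : ∀ s, s ∉ Finset.univ.image (extinctionTime T R) → ∀ j, s ≠ extinctionTime T R j :=
    fun s hs j hj => hs (Finset.mem_image.2 ⟨j, Finset.mem_univ _, hj.symm⟩)
  have hsub : ∀ s ∈ Ioo a b, s ∈ Ioo 0 T := fun s hs => ⟨ha.1.trans_lt hs.1, hs.2.trans hb.2⟩
  refine antitoneOn_of_hasDerivAt_nonpos_off_finset (Finset.univ.image (extinctionTime T R))
    (h.continuousOn_half_sum_sq.mono fun s hs => ⟨ha.1.trans hs.1, hs.2.trans_lt hb.2⟩)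
    (fun s hs hsE => h.hasDerivAt_half_sum_sq (hsub s hs) (hne s hsE)) (fun s hs hsE => ?_)
    (left_mem_Icc.2 hab) (right_mem_Icc.2 hab) hab
  have h1 := h.sum_sq_mul_sq_le hΩ hδ (hsub s hs) (hne s hsE)
  have h2 : 0 ≤ ∑ i, R i s ^ 2 * |deriv (R i) s| ^ 2 :=
    Finset.sum_nonneg fun i _ => by positivity
  linarith

theorem ae_forall_ne_extinctionTime {N : ℕ} (T : ℝ) (R : Fin N → ℝ → ℝ) (μ : Measure ℝ)
    [NullSingletonClass μ] : ∀ᵐ s ∂μ, ∀ j, s ≠ extinctionTime T R j :=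
  ae_all_iff.2 fun _ => compl_mem_ae_iff.2 (measure_singleton _)

end IsSolution
end ReactionLSW

end

/-! ### Integration in time -/

theorem lemma2p1 {N : ℕ} (Ω : Set ReactionLSW.E3) (hΩo : IsOpen Ω)
    (hΩb : Bornology.IsBounded Ω) (δ α T : ℝ) (hδ : 0 < δ)
    (x : Fin N → ReactionLSW.E3) (R : Fin N → ℝ → ℝ) (u : ℝ → ReactionLSW.E3 → ℝ)
    (h : ReactionLSW.IsSolution Ω δ α T x R u) :
    (∀ t ∈ Set.Ioo 0 T,
      (∀ i, IntervalIntegrable (fun s => R i s ^ 2 * |deriv (R i) s| ^ 2)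
        MeasureTheory.volume 0 t) ∧
      IntervalIntegrable (ReactionLSW.dirichletEnergy Ω δ α x R u) MeasureTheory.volume 0 t ∧
      (∑ i, ∫ s in (0 : ℝ)..t, R i s ^ 2 * |deriv (R i) s| ^ 2)
        + 1 / 2 * ∑ i, R i t ^ 2
        + 1 / (4 * Real.pi * δ ^ (2 * α))
          * ∫ s in (0 : ℝ)..t, ReactionLSW.dirichletEnergy Ω δ α x R u s
        = 1 / 2 * ∑ i, R i 0 ^ 2) ∧
    AntitoneOn (ReactionLSW.surfaceArea δ α R) (Set.Ico 0 T) := by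
  have hanti := h.antitoneOn_half_sum_sq hΩo hδ
  refine ⟨fun t ht => ?_, ?_⟩
  · set f : ℝ → ℝ := fun s => 1 / 2 * ∑ i, R i s ^ 2 with hf
    set f' : ℝ → ℝ := fun s => ∑ i, R i s * deriv (R i) s with hf'
    set g : Fin N → ℝ → ℝ := fun i s => R i s ^ 2 * |deriv (R i) s| ^ 2 with hg
    have hae : ∀ᵐ s ∂volume.restrict (uIoc 0 t),
        s ∈ Ioo 0 T ∧ ∀ j, s ≠ ReactionLSW.extinctionTime T R j := by
      filter_upwards [ae_restrict_mem measurableSet_uIoc,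
        ReactionLSW.IsSolution.ae_forall_ne_extinctionTime T R _] with s hs hne
      rw [uIoc_of_le ht.1.le] at hs
      exact ⟨⟨hs.1, hs.2.trans_lt ht.2⟩, hne⟩
    have hIcc : uIcc 0 t ⊆ Ico 0 T := by
      rw [uIcc_of_le ht.1.le]
      exact fun s hs => ⟨hs.1, hs.2.trans_lt ht.2⟩
    have hf'i : IntervalIntegrable f' volume 0 t := by
      -- Monotonicity alone makes the derivative integrable; the sign is flipped to pass from
      -- antitone to monotone.
      have h1 : IntervalIntegrable (deriv f) volume 0 t := by
        have := (hanti.mono hIcc).neg.intervalIntegrable_deriv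
        rw [deriv.fun_neg'] at this
        exact this.neg.congr fun s _ => neg_neg _
      refine h1.congr_ae ?_
      filter_upwards [hae] with s hs
      exact (h.hasDerivAt_half_sum_sq hs.1 hs.2).deriv
    have hgi : ∀ i, IntervalIntegrable (g i) volume 0 t := by
      intro i
      refine hf'i.neg.mono_fun' ?_ ?_
      · have hm : Measurable fun s => |deriv (R i) s| ^ 2 := by
          simp only [sq_abs]
          exact (measurable_deriv _).pow_const 2
        refine AEStronglyMeasurable.mul ?_ hm.aestronglyMeasurable
        refine (((h.continuousOn i).mono ?_).pow 2).aestronglyMeasurable measurableSet_uIoc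
        exact uIoc_subset_uIcc.trans hIcc
      · filter_upwards [hae] with s hs
        have hg0 : ∀ j, 0 ≤ g j s := fun j => by positivity
        rw [Real.norm_of_nonneg (hg0 i)]
        exact (Finset.single_le_sum (fun j _ => hg0 j) (Finset.mem_univ i)).trans
          (h.sum_sq_mul_sq_le hΩo hδ hs.1 hs.2)
    -- Integrability of the energy, measurability included, is inherited from this a.e. formula in
    -- the radii.
    have hD : ∀ᵐ s ∂volume.restrict (uIoc 0 t), 4 * Real.pi * δ ^ (2 * α) * -(f' s + ∑ i, g i s) =
        ReactionLSW.dirichletEnergy Ω δ α x R u s := by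
      filter_upwards [hae] with s hs
      rw [h.dirichletEnergy_eq hΩo hδ hs.1 hs.2, Finset.sum_add_distrib]
    have hsum : IntervalIntegrable (fun s => ∑ i, g i s) volume 0 t := by
      simpa only [Finset.sum_fn] using IntervalIntegrable.sum Finset.univ fun i _ => hgi i
    refine ⟨hgi, ((hf'i.add hsum).neg.const_mul _).congr_ae hD, ?_⟩
    -- Continuity of `f` across the finitely many extinction times excludes jump terms.
    have hFTC : ∫ s in (0 : ℝ)..t, f' s = f t - f 0 := by
      refine integral_eq_of_hasDerivAt_off_countable f f'
        (finite_range (ReactionLSW.extinctionTime T R)).countable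
        (h.continuousOn_half_sum_sq.mono hIcc) (fun s hs => ?_) hf'i
      rw [min_eq_left ht.1.le, max_eq_right ht.1.le] at hs
      exact h.hasDerivAt_half_sum_sq ⟨hs.1.1, hs.1.2.trans ht.2⟩
        fun j hj => hs.2 ⟨j, hj.symm⟩
    have hδ2 : 0 < δ ^ (2 * α) := Real.rpow_pos_of_pos hδ _
    have hK : 4 * Real.pi * δ ^ (2 * α) ≠ 0 := by positivity
    rw [← intervalIntegral.integral_congr_ae_restrict hD, intervalIntegral.integral_const_mul,
      intervalIntegral.integral_neg, intervalIntegral.integral_add hf'i hsum, hFTC,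
      intervalIntegral.integral_finsetSum fun i _ => hgi i, ← mul_assoc, one_div_mul_cancel hK]
    simp only [hf]
    ring
  · intro a ha b hb hab
    have hle := hanti ha hb hab
    have e : ∀ s, ReactionLSW.surfaceArea δ α R s =
        8 * Real.pi * (δ ^ α) ^ 2 * (1 / 2 * ∑ i, R i s ^ 2) := by
      intro s
      rw [ReactionLSW.surfaceArea, Finset.mul_sum, Finset.mul_sum]
      exact Finset.sum_congr rfl fun i _ => by ring
    rw [e, e]
    exact mul_le_mul_of_nonneg_left hle (by positivity)
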